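/- Let $k$ be a field of characteristic $p>2$, let $n\ge 0$ be an integer, let $R=k[[x,y]]/\bigl(xy(x^{p^n}+y^{p^n})\bigr)$, and let $\mathfrak m=(x,y)R$ be the maximal ideal of $R$. Then $$\mathfrak m^{p^n+2}=(x+2y)\,\mathfrak m^{p^n+1}\qquad\text{and}\qquad \mathrm{g}\ell\ell(R)=\mathrm{index}(R)=p^n+2 .$$ Here the generalized Loewy length $\mathrm{g}\ell\ell(R)$ is the smallest positive integer $g$ such that $\mathfrak m^g$ is contained in an ideal generated by a system of parameters of $R$. For a finitely generated $R$-module $M$, Auslander's invariant $\delta_R(M)$ is the smallest integer $r\ge 0$ for which there is a surjective $R$-linear map $X\oplus R^r\to M$ with $X$ a maximal Cohen–Macaulay $R$-module (possibly zero) having no nonzero free direct summand, and $\mathrm{index}(R)=\inf\{i\ge 1 : \delta_R(R/\mathfrak m^i)=1\}$. -/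

import Mathlib

open IsLocalRing

universe u v

namespace LoewyIndex

/-- `x₁, …, x_d` is a system of parameters of the local ring `R`: `d = dim R` and the ideal
`(x₁, …, x_d)` is primary to the maximal ideal (its radical is the maximal ideal). -/
def IsSystemOfParameters (R : Type u) [CommRing R] [IsLocalRing R] (xs : List R) : Prop :=
  (xs.length : WithBot ℕ∞) = ringKrullDim R ∧ (∀ x ∈ xs, x ∈ maximalIdeal R) ∧
    (Ideal.ofList xs).radical = maximalIdeal R

/-- The generalized Loewy length of a local ring `R`: the smallest positive integer `n` such that
`𝔪 ^ n` is contained in the ideal generated by a system of parameters (`⊤` if there is none). -/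
noncomputable def gll (R : Type u) [CommRing R] [IsLocalRing R] : ℕ∞ :=
  sInf ((fun n : ℕ => (n : ℕ∞)) ''
    {n : ℕ | 1 ≤ n ∧ ∃ xs : List R, IsSystemOfParameters R xs ∧
      maximalIdeal R ^ n ≤ Ideal.ofList xs})

/-- A finitely generated module `X` over a local ring `R` is maximal Cohen-Macaulay if it is zero
or has depth `dim R`, i.e. there is an `X`-regular sequence of length `dim R` in the maximal
ideal. (The depth of a nonzero finitely generated module never exceeds `dim R`; the zero module
is maximal Cohen-Macaulay by the usual convention.) -/
def IsMaximalCohenMacaulay (R : Type u) [CommRing R] [IsLocalRing R]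
    (X : Type v) [AddCommGroup X] [Module R X] : Prop :=
  Module.Finite R X ∧
    (Subsingleton X ∨ ∃ xs : List R, (∀ x ∈ xs, x ∈ maximalIdeal R) ∧
      RingTheory.Sequence.IsRegular X xs ∧ (xs.length : WithBot ℕ∞) = ringKrullDim R)

/-- `X` has no free direct summand other than zero. -/
def HasNoFreeSummand (R : Type u) [CommRing R]
    (X : Type v) [AddCommGroup X] [Module R X] : Prop :=
  ∀ F N : Submodule R X, IsCompl F N → Module.Free R F → F = ⊥

/-- Auslander's `δ`-invariant of a finitely generated module `M`: the smallest `n` such that there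
is a surjective `R`-linear map `X ⊕ Rⁿ → M` with `X` maximal Cohen-Macaulay without free direct
summand. -/
noncomputable def delta (R : Type u) [CommRing R] [IsLocalRing R]
    (M : Type v) [AddCommGroup M] [Module R M] : ℕ :=
  sInf {n : ℕ | ∃ (X : Type u) (_ : AddCommGroup X) (_ : Module R X),
    IsMaximalCohenMacaulay R X ∧ HasNoFreeSummand R X ∧
      ∃ f : X × (Fin n → R) →ₗ[R] M, Function.Surjective f}

/-- The index of `R`: the infimum of the `n ≥ 1` with `δ(R / 𝔪 ^ n) = 1` (`⊤` if there is none). -/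
noncomputable def index (R : Type u) [CommRing R] [IsLocalRing R] : ℕ∞ :=
  sInf ((fun n : ℕ => (n : ℕ∞)) '' {n : ℕ | 1 ≤ n ∧ delta R (R ⧸ maximalIdeal R ^ n) = 1})

/-- The power series `xy(x^q + y^q)` in `k⟦x, y⟧`. -/
noncomputable def equation (k : Type u) [Field k] (q : ℕ) : MvPowerSeries (Fin 2) k :=
  MvPowerSeries.X 0 * MvPowerSeries.X 1 * (MvPowerSeries.X 0 ^ q + MvPowerSeries.X 1 ^ q)

/-- The ring `k⟦x, y⟧ / (xy(x^q + y^q))`. -/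
abbrev HypersurfaceRing (k : Type u) [Field k] (q : ℕ) : Type u :=
  MvPowerSeries (Fin 2) k ⧸ Ideal.span {equation k q}

/-- The class of `x`. -/
noncomputable def xbar (k : Type u) [Field k] (q : ℕ) : HypersurfaceRing k q :=
  Ideal.Quotient.mk _ (MvPowerSeries.X 0)

/-- The class of `y`. -/
noncomputable def ybar (k : Type u) [Field k] (q : ℕ) : HypersurfaceRing k q :=
  Ideal.Quotient.mk _ (MvPowerSeries.X 1)

instance instNontrivialHypersurfaceRing (k : Type u) [Field k] (q : ℕ) :
    Nontrivial (HypersurfaceRing k q) := by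
  rw [Ideal.Quotient.nontrivial_iff, Ne, Ideal.span_singleton_eq_top]
  intro h
  have h2 := MvPowerSeries.isUnit_constantCoeff _ h
  simp [equation] at h2

instance instIsLocalRingHypersurfaceRing (k : Type u) [Field k] (q : ℕ) :
    IsLocalRing (HypersurfaceRing k q) :=
  IsLocalRing.of_surjective' (Ideal.Quotient.mk _) Ideal.Quotient.mk_surjective

end LoewyIndex

/-! Write q = p^n and z = x + 2y. By Frobenius, x^q + y^q = (x + y)^q = (z - y)^q, so the equation
becomes (z - 2y) y (z^q - y^q), which is 2y^(q+2) modulo z. As 2 is a unit, y^(q+2) lies in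
z𝔪^(q+1); this gives the equality of ideals and bounds the generalized Loewy length by q + 2.

Both lower bounds come from g = y(x^q + y^q), a nonzero element of 𝔪^(q+1) with ann(x) = (g). If
𝔪^(q+1) lay in a parameter ideal (w), dividing g by w would give g = wbg, hence g = 0. For j ≤ q +
1, the module R/g maps onto R/𝔪^j; it is maximal Cohen–Macaulay without free summand, so δ = 0
(`delta_quotient_eq_zero`).

For δ(R/𝔪^(q+2)) = 1, note that R/𝔪^(q+2) maps onto R/z. A maximal Cohen–Macaulay module mapping
onto R/z has a free summand (`PowerSeries.exists_isCompl_free`): over A = k⟦z⟧ both R and the module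
are free, and R/z is self-dual through the coefficient of y^(q+1). Lifting this functional to the
module splits off a copy of R. -/

/-! ### Duality over a local domain and free summands -/

/-- If `lam : R → A` induces modulo `ϖ` a functional `R → A / ϖ` that generates all functionals,
then `lam` generates the dual of the finite free `A`-algebra `R` freely. -/
theorem bijective_smul_dual {A R : Type*} [CommRing A] [IsDomain A] [IsLocalRing A] [CommRing R]
    [Algebra A R] [Module.Finite A R] [Module.Free A R] (ϖ : A) (hϖ : ϖ ≠ 0)
    (hmem : ϖ ∈ maximalIdeal A) (lam : R →ₗ[A] A)
    (hperf : ∀ l : R →ₗ[A] A ⧸ Ideal.span {ϖ}, ∃ r : R, ∀ s : R,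
      l s = Ideal.Quotient.mk _ (lam (r * s))) :
    Function.Bijective (lam.compRight A ∘ₗ (LinearMap.mul A R)) := by
  set T : R →ₗ[A] (R →ₗ[A] A) := lam.compRight A ∘ₗ (LinearMap.mul A R) with hT
  have hTa : ∀ r s, T r s = lam (r * s) := fun r s => rfl
  have hsurj : Function.Surjective T := by
    -- Nakayama: it suffices that every functional agrees with some `T r` modulo `ϖ`.
    rw [← LinearMap.range_eq_top, ← top_le_iff]
    refine Submodule.le_of_le_smul_of_le_jacobson_bot (I := Ideal.span {ϖ})
      Module.Finite.fg_top ?_ ?_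
    · rw [IsLocalRing.jacobson_eq_maximalIdeal _ bot_ne_top, Ideal.span_singleton_le_iff_mem]
      exact hmem
    · intro l _
      obtain ⟨r, hr⟩ := hperf ((Ideal.span {ϖ}).mkQ ∘ₗ l)
      have hdvd : ∀ s, ∃ c, (l - T r) s = ϖ * c := by
        intro s
        have h : Ideal.Quotient.mk (Ideal.span {ϖ}) (l s) = Ideal.Quotient.mk _ (lam (r * s)) :=
          hr s
        rw [Ideal.Quotient.eq, Ideal.mem_span_singleton'] at h
        obtain ⟨c, hc⟩ := h
        exact ⟨c, by rw [LinearMap.sub_apply, hTa, ← hc, mul_comm]⟩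
      choose c hc using hdvd
      let l' : R →ₗ[A] A :=
        { toFun := c
          map_add' := fun a b => mul_left_cancel₀ hϖ (by
            rw [mul_add, ← hc, ← hc, ← hc, map_add])
          map_smul' := fun a b => mul_left_cancel₀ hϖ (by
            rw [← hc, map_smul, hc, smul_eq_mul, RingHom.id_apply, smul_eq_mul]; ring) }
      have hl : l = T r + ϖ • l' := by
        ext s
        have := hc s
        rw [LinearMap.sub_apply, sub_eq_iff_eq_add'] at this
        simpa [l'] using this
      rw [hl]
      exact Submodule.add_mem_sup ⟨r, rfl⟩
        (Submodule.smul_mem_smul (Ideal.mem_span_singleton_self ϖ) trivial)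
  refine ⟨?_, hsurj⟩
  -- `R` and its dual are isomorphic over `A`, so a surjection between them is injective.
  let e := (Module.Free.chooseBasis A R).toDualEquiv
  have h : Function.Injective (e.symm.toLinearMap ∘ₗ T) :=
    OrzechProperty.injective_of_surjective_endomorphism _ (e.symm.surjective.comp hsurj)
  exact fun a b hab => h (by simp [hab])

/-- Let `R` be a finite free algebra over a local domain `A` such that `R / ϖR` has a functional
generating all functionals. If a finite `R`-module `X` that is free over `A` has an `R`-linear
map onto `R / ϖR`, then `X` has a free direct summand. -/
theorem exists_isCompl_free_of_map_quotient {A R X : Type*} [CommRing A] [IsDomain A]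
    [IsLocalRing A] [CommRing R] [Nontrivial R] [Algebra A R] [Module.Finite A R]
    [Module.Free A R] (ϖ : A) (hϖ : ϖ ≠ 0) (hmem : ϖ ∈ maximalIdeal A)
    (lam : R ⧸ Ideal.span {algebraMap A R ϖ} →ₗ[A] A ⧸ Ideal.span {ϖ})
    (hperf : ∀ l : R →ₗ[A] A ⧸ Ideal.span {ϖ}, ∃ r : R, ∀ s : R,
      l s = lam (Ideal.Quotient.mk _ (r * s)))
    [AddCommGroup X] [Module R X] [Module A X] [IsScalarTower A R X] [Module.Projective A X]
    (φ : X →ₗ[R] R ⧸ Ideal.span {algebraMap A R ϖ}) (x₀ : X) (hx₀ : φ x₀ = 1) :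
    ∃ F N : Submodule R X, IsCompl F N ∧ Module.Free R F ∧ F ≠ ⊥ := by
  obtain ⟨μ, hμ⟩ := Module.projective_lifting_property (Ideal.span {ϖ}).mkQ
    (lam ∘ₗ φ.restrictScalars A) (Submodule.mkQ_surjective _)
  have hμ' : ∀ x, Ideal.Quotient.mk _ (μ x) = lam (φ x) := fun x => LinearMap.congr_fun hμ x
  let lam₀ : R →ₗ[A] A := μ ∘ₗ (LinearMap.toSpanSingleton R X x₀).restrictScalars A
  have hlam₀ : ∀ r, lam₀ r = μ (r • x₀) := fun r => rfl
  have hφ : ∀ r, φ (r • x₀) = Ideal.Quotient.mk _ r := fun r => by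
    rw [map_smul, hx₀, Algebra.smul_def, mul_one]; rfl
  obtain ⟨hinj, hsurj⟩ := bijective_smul_dual ϖ hϖ hmem lam₀ fun l => by
    obtain ⟨r, hr⟩ := hperf l
    exact ⟨r, fun s => by rw [hr, hlam₀, hμ', hφ]⟩
  have hT : ∀ r s, (lam₀.compRight A ∘ₗ (LinearMap.mul A R)) r s = μ ((r * s) • x₀) :=
    fun r s => rfl
  have hann : ∀ r : R, (∀ s : R, μ (s • r • x₀) = 0) → r = 0 := fun r hr =>
    hinj (by ext s; rw [hT, map_zero, LinearMap.zero_apply, mul_comm, mul_smul, hr])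
  -- The largest `R`-submodule in the kernel of `μ`; perfection of the pairing `μ ((r * s) • x₀)`
  -- makes it a complement of `R ∙ x₀`.
  let N : Submodule R X :=
    { carrier := {x | ∀ r : R, μ (r • x) = 0}
      add_mem' := fun ha hb r => by rw [smul_add, map_add, ha r, hb r, add_zero]
      zero_mem' := fun r => by simp
      smul_mem' := fun c x hx r => by rw [← mul_smul]; exact hx _ }
  refine ⟨R ∙ x₀, N, ⟨?_, ?_⟩, ?_, ?_⟩
  · rw [Submodule.disjoint_def]
    intro x hx hN
    obtain ⟨r, rfl⟩ := Submodule.mem_span_singleton.mp hx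
    rw [hann r hN, zero_smul]
  · rw [codisjoint_iff_le_sup]
    intro x _
    obtain ⟨r, hr⟩ := hsurj (μ ∘ₗ (LinearMap.toSpanSingleton R X x).restrictScalars A)
    rw [← add_sub_cancel (r • x₀) x]
    refine Submodule.add_mem_sup (Submodule.smul_mem _ _ (Submodule.mem_span_singleton_self x₀)) ?_
    intro s
    have h : μ ((r * s) • x₀) = μ (s • x) := LinearMap.congr_fun hr s
    rw [smul_sub, map_sub, ← h, mul_comm, mul_smul, sub_self]
  · rw [← LinearMap.range_toSpanSingleton]
    refine Module.Free.of_equiv (LinearEquiv.ofInjective (LinearMap.toSpanSingleton R X x₀) ?_)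
    rw [injective_iff_map_eq_zero]
    intro r hr
    rw [LinearMap.toSpanSingleton_apply] at hr
    exact hann r fun s => by rw [hr, smul_zero, map_zero]
  · rw [Ne, Submodule.span_singleton_eq_bot]
    rintro rfl
    exact one_ne_zero (hann 1 fun s => by simp)

/-! ### Change of coordinates in k⟦x, y⟧ -/

namespace PowerSeries

/-- The ring `k⟦x, y⟧` as an iterated power series ring in the variables `x + 2y` and `y`. -/
theorem exists_ringEquiv_mvPowerSeries (k : Type*) [Field k] :
    ∃ e : MvPowerSeries (Fin 2) k ≃+* PowerSeries (PowerSeries k),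
      e (MvPowerSeries.X 0) = C X - 2 * X ∧ e (MvPowerSeries.X 1) = X := by
  -- Substituting x - 2y for x turns x + 2y into a variable; `b` is the inverse substitution.
  let a : Fin 2 → MvPowerSeries (Fin 2) k :=
    ![MvPowerSeries.X 0 - 2 * MvPowerSeries.X 1, MvPowerSeries.X 1]
  let b : Fin 2 → MvPowerSeries (Fin 2) k :=
    ![MvPowerSeries.X 0 + 2 * MvPowerSeries.X 1, MvPowerSeries.X 1]
  have ha : MvPowerSeries.HasSubst a :=
    MvPowerSeries.hasSubst_of_constantCoeff_zero fun i => by fin_cases i <;> simp [a]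
  have hb : MvPowerSeries.HasSubst b :=
    MvPowerSeries.hasSubst_of_constantCoeff_zero fun i => by fin_cases i <;> simp [b]
  have hbX (i : Fin 2) : MvPowerSeries.substAlgHom (R := k) hb (MvPowerSeries.X i) = b i :=
    MvPowerSeries.substAlgHom_X hb i
  have haX (i : Fin 2) : MvPowerSeries.substAlgHom (R := k) ha (MvPowerSeries.X i) = a i :=
    MvPowerSeries.substAlgHom_X ha i
  have hab (i : Fin 2) : MvPowerSeries.substAlgHom (R := k) hb (a i) = MvPowerSeries.X i := by
    fin_cases i
    · simp only [a, Fin.zero_eta, Matrix.cons_val_zero, map_sub, map_mul, map_ofNat, hbX]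
      simp [b]
    · simp [a, hbX, b]
  have hba (i : Fin 2) : MvPowerSeries.substAlgHom (R := k) ha (b i) = MvPowerSeries.X i := by
    fin_cases i
    · simp only [b, Fin.zero_eta, Matrix.cons_val_zero, map_add, map_mul, map_ofNat, haX]
      simp [a]
    · simp [b, haX, a]
  let σ : MvPowerSeries (Fin 2) k ≃+* MvPowerSeries (Fin 2) k :=
    RingEquiv.ofRingHom (MvPowerSeries.substAlgHom (R := k) ha).toRingHom
      (MvPowerSeries.substAlgHom (R := k) hb).toRingHom
      (by
        ext1 f
        simp only [AlgHom.toRingHom_eq_coe, RingHom.comp_apply, RingHom.coe_coe, RingHom.id_apply]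
        rw [MvPowerSeries.substAlgHom_comp_substAlgHom_apply, MvPowerSeries.substAlgHom_apply]
        simp only [hba]
        exact congrFun MvPowerSeries.subst_self f)
      (by
        ext1 f
        simp only [AlgHom.toRingHom_eq_coe, RingHom.comp_apply, RingHom.coe_coe, RingHom.id_apply]
        rw [MvPowerSeries.substAlgHom_comp_substAlgHom_apply, MvPowerSeries.substAlgHom_apply]
        simp only [hab]
        exact congrFun MvPowerSeries.subst_self f)
  have hσ (i : Fin 2) : σ (MvPowerSeries.X i) = a i := haX i
  let ι : Fin 2 ≃ Option Unit :=
    (finSuccEquivLast (n := 1)).trans (Equiv.optionCongr (Equiv.ofUnique _ _))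
  have hι0 : ι 0 = some () := rfl
  have hι1 : ι 1 = none := rfl
  let e' := (MvPowerSeries.renameEquiv k ι).trans (MvPowerSeries.optionEquivLeft Unit k)
  have he0 : e' (MvPowerSeries.X 0) = C X := by
    simp [e', MvPowerSeries.renameEquiv, hι0]; rfl
  have he1 : e' (MvPowerSeries.X 1) = X := by
    simp [e', MvPowerSeries.renameEquiv, hι1]
  refine ⟨σ.trans e'.toRingEquiv, ?_, ?_⟩
  · rw [RingEquiv.trans_apply, hσ]
    simp only [a, Matrix.cons_val_zero, map_sub, map_mul, map_ofNat]
    exact congrArg₂ _ he0 (congrArg _ he1)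
  · rw [RingEquiv.trans_apply, hσ]
    exact he1

/-! ### Quotients of A⟦X⟧ by one equation, over a discrete valuation ring -/

section Quotient

variable {A : Type*} [CommRing A] [IsDomain A] [IsDiscreteValuationRing A] {ϖ : A}

theorem C_dvd_iff_map_residue_eq_zero (hϖ : Irreducible ϖ) {f : PowerSeries A} :
    C ϖ ∣ f ↔ f.map (residue A) = 0 := by
  have h (a : A) : ϖ ∣ a ↔ residue A a = 0 := by
    rw [residue_eq_zero_iff, hϖ.maximalIdeal_eq, Ideal.mem_span_singleton]
  constructor
  · rintro ⟨g, rfl⟩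
    rw [map_mul, map_C, (h ϖ).mp dvd_rfl, map_zero, zero_mul]
  · intro hf
    have h' (n : ℕ) : ϖ ∣ coeff n f := by
      rw [h]
      simpa using congrArg (coeff n) hf
    choose g hg using h'
    exact ⟨mk g, by ext1 n; simp [hg]⟩

theorem _root_.Irreducible.isTorsionFree_of_smul {M : Type*} [AddCommGroup M] [Module A M]
    (hϖ : Irreducible ϖ) (h : ∀ m : M, ϖ • m = 0 → m = 0) : Module.IsTorsionFree A M := by
  refine Module.IsTorsionFree.of_smul_eq_zero fun r m hrm => ?_
  by_contra! hr
  obtain ⟨n, u, rfl⟩ := IsDiscreteValuationRing.eq_unit_mul_pow_irreducible hr.1 hϖ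
  rw [mul_smul, ← Units.smul_def, smul_eq_zero_iff_eq] at hrm
  refine hr.2 ?_
  clear hr
  induction n with
  | zero => simpa using hrm
  | succ n ih => exact ih (h _ (by rwa [← mul_smul, ← pow_succ']))

variable {R : Type*} [CommRing R] [Algebra A R] {π : PowerSeries A →+* R} {F : PowerSeries A}

/-- Reduction modulo `ϖ` lands in power series over a field, a domain; so if `C ϖ` divides `F * b`
but not `F`, it divides `b`. -/
theorem eq_zero_of_smul_eq_zero_of_surjective (hπ : Function.Surjective π)
    (hC : ∀ a, π (C a) = algebraMap A R a) (hker : ∀ a, π a = 0 ↔ F ∣ a)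
    (hϖ : Irreducible ϖ) (hF : F.map (residue A) ≠ 0) (r : R) (hr : ϖ • r = 0) : r = 0 := by
  obtain ⟨a, rfl⟩ := hπ r
  rw [Algebra.smul_def, ← hC, ← map_mul, hker] at hr
  obtain ⟨b, hb⟩ := hr
  have h : C ϖ ∣ F * b := ⟨a, hb.symm⟩
  rw [C_dvd_iff_map_residue_eq_zero hϖ, map_mul, mul_eq_zero, or_iff_right hF,
    ← C_dvd_iff_map_residue_eq_zero hϖ] at h
  obtain ⟨c, rfl⟩ := h
  rw [hker]
  refine ⟨c, mul_left_cancel₀ (a := C ϖ) ?_ (by rw [hb]; ring)⟩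
  rw [Ne, map_eq_zero_iff _ C_injective]
  exact hϖ.ne_zero

/-- Weierstrass division by `F` leaves polynomial remainders of bounded degree, so finitely many
powers of `π X` generate. -/
theorem finite_of_surjective [IsAdicComplete (maximalIdeal A) A] (hπ : Function.Surjective π)
    (hC : ∀ a, π (C a) = algebraMap A R a) (hker : ∀ a, π a = 0 ↔ F ∣ a)
    (hF : F.map (residue A) ≠ 0) : Module.Finite A R := by
  set N := (F.map (residue A)).order.toNat
  have : (⊤ : Submodule A R) = Submodule.span A (Set.range fun i : Fin N => π X ^ (i : ℕ)) := by
    refine (eq_top_iff.mpr ?_).symm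
    rintro r -
    obtain ⟨a, rfl⟩ := hπ r
    obtain ⟨q, r, hlt, rfl⟩ := exists_isWeierstrassDivision (f := a) hF
    rw [map_add, (hker (F * q)).mpr ⟨q, rfl⟩, zero_add]
    have hr : π (r : PowerSeries A) = ∑ i ∈ Finset.range N, r.coeff i • π X ^ i := by
      have h : (r : PowerSeries A) = ∑ i ∈ Finset.range N, C (r.coeff i) * X ^ i := by
        ext n
        rw [Polynomial.coeff_coe, map_sum]
        simp only [coeff_C_mul, coeff_X_pow, mul_ite, mul_one, mul_zero, Finset.sum_ite_eq,
          Finset.mem_range]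
        split_ifs with hn
        · rfl
        · exact Polynomial.coeff_eq_zero_of_degree_lt
            (hlt.trans_le (by exact_mod_cast not_lt.mp hn))
      rw [h, map_sum]
      refine Finset.sum_congr rfl fun i _ => ?_
      rw [map_mul, hC, map_pow, Algebra.smul_def]
    rw [hr]
    exact Submodule.sum_mem _ fun i hi => Submodule.smul_mem _ _
      (Submodule.subset_span ⟨⟨i, Finset.mem_range.mp hi⟩, rfl⟩)
  exact ⟨this ▸ Submodule.fg_span (Set.finite_range _)⟩

/-- Modulo `ϖ` the equation is divisible by `X ^ (d + 1)`, so the coefficient of `X ^ d` survives in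
the quotient. -/
theorem exists_functional_quotient (hπ : Function.Surjective π)
    (hC : ∀ a, π (C a) = algebraMap A R a) (hker : ∀ a, π a = 0 ↔ F ∣ a) (hϖ : Irreducible ϖ)
    {d : ℕ} (hF : X ^ (d + 1) ∣ F.map (residue A)) :
    ∃ lam : R ⧸ Ideal.span {algebraMap A R ϖ} →ₗ[A] A ⧸ Ideal.span {ϖ},
      ∀ a, lam (Ideal.Quotient.mk _ (π a)) = Ideal.Quotient.mk _ (coeff d a) := by
  let πₐ : PowerSeries A →ₐ[A] R := { π with commutes' := fun a => hC a }
  let ρ : PowerSeries A →ₗ[A] R ⧸ Ideal.span {algebraMap A R ϖ} :=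
    (Ideal.Quotient.mkₐ A _).toLinearMap ∘ₗ πₐ.toLinearMap
  have hρ : Function.Surjective ρ := Ideal.Quotient.mk_surjective.comp hπ
  let lam : PowerSeries A →ₗ[A] A ⧸ Ideal.span {ϖ} := Submodule.mkQ _ ∘ₗ coeff d
  have hle : LinearMap.ker ρ ≤ LinearMap.ker lam := by
    intro a ha
    have ha' : π a ∈ Ideal.span {algebraMap A R ϖ} := Ideal.Quotient.eq_zero_iff_mem.mp ha
    obtain ⟨r, hr⟩ := Ideal.mem_span_singleton.mp ha'
    obtain ⟨b, rfl⟩ := hπ r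
    have h : π (a - C ϖ * b) = 0 := by rw [map_sub, hr, map_mul, hC, sub_self]
    obtain ⟨g, hg⟩ := (hker _).mp h
    have ha0 := congrArg (map (residue A)) hg
    rw [map_mul, map_sub, (C_dvd_iff_map_residue_eq_zero hϖ).mp (dvd_mul_right _ _), sub_zero] at ha0
    have h0 := X_pow_dvd_iff.mp (hF.mul_right (map (residue A) g)) d d.lt_succ_self
    rw [← ha0, coeff_map, residue_eq_zero_iff, hϖ.maximalIdeal_eq] at h0
    exact Ideal.Quotient.eq_zero_iff_mem.mpr h0
  refine ⟨(LinearMap.ker ρ).liftQ lam hle ∘ₗ (ρ.quotKerEquivOfSurjective hρ).symm.toLinearMap,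
    fun a => ?_⟩
  have : (ρ.quotKerEquivOfSurjective hρ).symm (Ideal.Quotient.mk _ (π a)) =
      Submodule.Quotient.mk a := by
    rw [LinearEquiv.symm_apply_eq]; rfl
  rw [LinearMap.comp_apply, LinearEquiv.coe_coe, this]
  rfl

-- Modulo `ϖ`, a functional is determined by its values on the powers `X ^ j` with `j ≤ d`, and
-- multiplication by `X ^ (d - j)` moves the coefficient of `X ^ j` to degree `d`.
omit [IsDomain A] [IsDiscreteValuationRing A] in
theorem exists_eq_functional_mul (hπ : Function.Surjective π)
    (hC : ∀ a, π (C a) = algebraMap A R a) {d : ℕ}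
    (hX : π X ^ (d + 1) ∈ Ideal.span {algebraMap A R ϖ})
    (lam : R ⧸ Ideal.span {algebraMap A R ϖ} →ₗ[A] A ⧸ Ideal.span {ϖ})
    (hlam : ∀ a, lam (Ideal.Quotient.mk _ (π a)) = Ideal.Quotient.mk _ (coeff d a))
    (l : R →ₗ[A] A ⧸ Ideal.span {ϖ}) :
    ∃ r : R, ∀ s : R, l s = lam (Ideal.Quotient.mk _ (r * s)) := by
  choose c hc using fun j : ℕ => Ideal.Quotient.mk_surjective (l (π (X ^ j)))
  have hmem : ∀ s ∈ Ideal.span {algebraMap A R ϖ}, l s = 0 := by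
    intro s hs
    obtain ⟨t, rfl⟩ := Ideal.mem_span_singleton.mp hs
    obtain ⟨b, hb⟩ := Ideal.Quotient.mk_surjective (l t)
    rw [← Algebra.smul_def, map_smul, ← hb]
    exact Ideal.Quotient.eq_zero_iff_mem.mpr
      (Ideal.mul_mem_right _ _ (Ideal.mem_span_singleton_self _))
  let a : PowerSeries A := ∑ j ∈ Finset.range (d + 1), C (c j) * X ^ (d - j)
  refine ⟨π a, fun s => ?_⟩
  obtain ⟨b, rfl⟩ := hπ s
  obtain ⟨b', hb'⟩ : X ^ (d + 1) ∣ b - ∑ j ∈ Finset.range (d + 1), C (coeff j b) * X ^ j := by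
    rw [X_pow_dvd_iff]
    intro m hm
    rw [map_sub, map_sum, Finset.sum_eq_single m]
    · simp
    · intro i _ hi
      rw [coeff_C_mul, coeff_X_pow, if_neg hi.symm, mul_zero]
    · intro h
      exact absurd (Finset.mem_range.mpr hm) h
  have hl : l (π b) = ∑ j ∈ Finset.range (d + 1), coeff j b • l (π (X ^ j)) := by
    have h0 := hmem (π (X ^ (d + 1) * b'))
      (by rw [map_mul, map_pow]; exact Ideal.mul_mem_right _ _ hX)
    rw [← hb', map_sub, map_sub, sub_eq_zero] at h0
    rw [h0, map_sum, map_sum]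
    refine Finset.sum_congr rfl fun j _ => ?_
    rw [map_mul, hC, ← Algebra.smul_def, map_smul]
  have hab : coeff d (a * b) = ∑ j ∈ Finset.range (d + 1), c j * coeff j b := by
    rw [Finset.sum_mul, map_sum]
    refine Finset.sum_congr rfl fun j hj => ?_
    rw [mul_assoc, coeff_C_mul, coeff_X_pow_mul', if_pos (Nat.sub_le _ _),
      Nat.sub_sub_self (by simpa [Nat.lt_succ_iff] using hj)]
  rw [← map_mul, hlam, hl, hab, map_sum]
  refine Finset.sum_congr rfl fun j _ => ?_
  rw [← hc, mul_comm]
  rfl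

/-- Let `R` be the quotient of `A⟦X⟧` by one equation that is not zero modulo `ϖ`. A finite
`R`-module on which `ϖ` is regular and that maps onto `R / ϖR` has a free direct summand. -/
theorem exists_isCompl_free [IsAdicComplete (maximalIdeal A) A] [Nontrivial R]
    (hπ : Function.Surjective π)
    (hC : ∀ a, π (C a) = algebraMap A R a) (hker : ∀ a, π a = 0 ↔ F ∣ a) (hϖ : Irreducible ϖ)
    {d : ℕ} (hF0 : F.map (residue A) ≠ 0) (hF : X ^ (d + 1) ∣ F.map (residue A))
    (hX : π X ^ (d + 1) ∈ Ideal.span {algebraMap A R ϖ})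
    {M : Type*} [AddCommGroup M] [Module R M] [Module.Finite R M]
    (hreg : ∀ m : M, algebraMap A R ϖ • m = 0 → m = 0)
    (φ : M →ₗ[R] R ⧸ Ideal.span {algebraMap A R ϖ}) (hφ : Function.Surjective φ) :
    ∃ F N : Submodule R M, IsCompl F N ∧ Module.Free R F ∧ F ≠ ⊥ := by
  let : Module A M := Module.compHom M (algebraMap A R)
  have : IsScalarTower A R M := IsScalarTower.of_algebraMap_smul fun _ _ => rfl
  have := finite_of_surjective hπ hC hker hF0
  have : Module.Finite A M := Module.Finite.trans R M
  have : Module.IsTorsionFree A R :=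
    hϖ.isTorsionFree_of_smul (eq_zero_of_smul_eq_zero_of_surjective hπ hC hker hϖ hF0)
  have : Module.IsTorsionFree A M :=
    hϖ.isTorsionFree_of_smul hreg
  obtain ⟨x₀, hx₀⟩ := hφ 1
  obtain ⟨lam, hlam⟩ := exists_functional_quotient hπ hC hker hϖ hF
  exact exists_isCompl_free_of_map_quotient ϖ hϖ.ne_zero
    (hϖ.maximalIdeal_eq ▸ Ideal.mem_span_singleton_self ϖ) lam
    (exists_eq_functional_mul hπ hC hX lam hlam) φ x₀ hx₀

end Quotient

end PowerSeries

/-! ### Dimension and the maximal ideal -/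

theorem ringKrullDim_eq_one_of_pow_le_span_singleton {R : Type*} [CommRing R] [IsLocalRing R]
    [IsNoetherianRing R] {z : R} (hz : z ∈ maximalIdeal R) (hreg : ∀ r, z * r = 0 → r = 0) {n : ℕ}
    (hn : maximalIdeal R ^ n ≤ Ideal.span {z}) : ringKrullDim R = 1 := by
  have hne : Ideal.span {z} ≠ ⊤ := fun h =>
    (maximalIdeal.isMaximal R).ne_top (top_le_iff.mp
      (h ▸ (Ideal.span_singleton_le_iff_mem _).mpr hz))
  have : Nontrivial (R ⧸ Ideal.span {z}) := Ideal.Quotient.nontrivial_iff.mpr hne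
  have h0 : Ring.KrullDimLE 0 (R ⧸ Ideal.span {z}) := by
    refine (((Ring.krullDimLE_zero_and_isLocalRing_tfae _).out 0 2 rfl rfl).mpr ?_).1
    intro x
    refine ⟨fun h h' => h'.not_isNilpotent h, fun h => ?_⟩
    obtain ⟨r, rfl⟩ := Ideal.Quotient.mk_surjective x
    refine ⟨n, ?_⟩
    rw [← map_pow, Ideal.Quotient.eq_zero_iff_mem]
    refine hn (Ideal.pow_mem_pow ?_ n)
    exact fun hu => h (hu.map _)
  rw [ringKrullDimZero_iff_ringKrullDim_eq_zero] at h0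
  have := ringKrullDim_quotient_span_singleton_succ_eq_ringKrullDim_of_mem_jacobson (x := z)
    (fun a b hab => sub_eq_zero.mp (hreg _ (by rw [mul_sub, sub_eq_zero]; exact hab)))
    (by
      rw [Ring.jacobson_eq_sInf_isMaximal]
      exact Submodule.mem_sInf.mpr fun I hI => eq_maximalIdeal hI ▸ hz)
  rw [← this, h0, zero_add]

/-- A product of `n + 1` factors from `I` or `J` either has a factor in `I` or lies in `J ^ (n +
1)`. -/
theorem Ideal.sup_pow_succ_le {R : Type*} [CommRing R] (I J : Ideal R) (n : ℕ) :
    (I ⊔ J) ^ (n + 1) ≤ I * (I ⊔ J) ^ n ⊔ J ^ (n + 1) := by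
  induction n with
  | zero => simp
  | succ n ih =>
    calc (I ⊔ J) ^ (n + 1 + 1) = I * (I ⊔ J) ^ (n + 1) ⊔ J * (I ⊔ J) ^ (n + 1) := by
          rw [pow_succ' _ (n + 1), Ideal.sup_mul]
      _ ≤ I * (I ⊔ J) ^ (n + 1) ⊔ J * (I * (I ⊔ J) ^ n ⊔ J ^ (n + 1)) := by gcongr
      _ ≤ _ := by
        rw [Ideal.mul_sup, ← pow_succ', ← sup_assoc]
        refine sup_le_sup_right (sup_le le_rfl ?_) _
        rw [mul_left_comm, pow_succ' _ n]
        gcongr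
        exact le_sup_right

theorem PowerSeries.maximalIdeal_eq_span_pair {A R : Type*} [CommRing A] [IsLocalRing A] {ϖ : A}
    (hϖ : maximalIdeal A = Ideal.span {ϖ}) [CommRing R] [IsLocalRing R] {π : PowerSeries A →+* R}
    (hπ : Function.Surjective π) :
    maximalIdeal R = Ideal.span {π (PowerSeries.C ϖ), π PowerSeries.X} := by
  have : IsLocalHom π := IsLocalHom.of_surjective π hπ
  have h (a : PowerSeries A) :
      π a ∈ maximalIdeal R ↔ PowerSeries.constantCoeff a ∈ Ideal.span {ϖ} := by
    rw [mem_maximalIdeal, map_mem_nonunits_iff, ← hϖ, mem_maximalIdeal, mem_nonunits_iff,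
      mem_nonunits_iff, PowerSeries.isUnit_iff_constantCoeff]
  apply le_antisymm
  · intro r hr
    obtain ⟨a, rfl⟩ := hπ r
    obtain ⟨b, hb⟩ := Ideal.mem_span_singleton.mp ((h a).mp hr)
    obtain ⟨c, hc⟩ : PowerSeries.X ∣ a - PowerSeries.C (PowerSeries.constantCoeff a) := by
      simp [PowerSeries.X_dvd_iff]
    rw [Ideal.mem_span_pair]
    refine ⟨π (PowerSeries.C b), π c, ?_⟩
    rw [← map_mul π, ← map_mul π, ← map_add, ← map_mul PowerSeries.C, mul_comm b, ← hb, mul_comm c,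
      ← hc, add_sub_cancel]
  · rw [Ideal.span_le]
    rintro _ (rfl | rfl)
    · exact (h _).mpr (by simp)
    · exact (h _).mpr (by simp)

namespace LoewyIndex

/-! ### Computing the δ-invariant -/

section Delta

variable {R : Type u} [CommRing R] [IsLocalRing R]

/-- The zero module together with `R → R / I` gives δ ≤ 1, so only δ = 0 has to be excluded. -/
theorem delta_quotient_eq_one {I : Ideal R}
    (h : ∀ (X : Type u) [AddCommGroup X] [Module R X], IsMaximalCohenMacaulay R X →
      HasNoFreeSummand R X → ∀ f : X →ₗ[R] R ⧸ I, ¬ Function.Surjective f) :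
    delta R (R ⧸ I) = 1 := by
  refine le_antisymm (Nat.sInf_le ⟨PUnit, inferInstance, inferInstance,
    ⟨inferInstance, Or.inl inferInstance⟩, fun F N _ _ => Subsingleton.elim _ _,
    Submodule.mkQ I ∘ₗ LinearMap.proj 0 ∘ₗ LinearMap.snd R _ _,
    (Submodule.mkQ_surjective I).comp fun r => ⟨(0, fun _ => r), rfl⟩⟩) ?_
  -- Nonemptiness matters here, because `sInf ∅ = 0` in `ℕ`.
  refine le_csInf ⟨1, PUnit, inferInstance, inferInstance,
    ⟨inferInstance, Or.inl inferInstance⟩, fun F N _ _ => Subsingleton.elim _ _,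
    Submodule.mkQ I ∘ₗ LinearMap.proj 0 ∘ₗ LinearMap.snd R _ _,
    (Submodule.mkQ_surjective I).comp fun r => ⟨(0, fun _ => r), rfl⟩⟩ ?_
  rintro n ⟨X, _, _, hX, hX', f, hf⟩
  rw [Nat.one_le_iff_ne_zero]
  rintro rfl
  refine h X hX hX' (f ∘ₗ LinearMap.inl R X _) fun m => ?_
  obtain ⟨⟨x, y⟩, rfl⟩ := hf m
  exact ⟨x, congrArg f (Prod.ext rfl (Subsingleton.elim _ _))⟩

/-- If `x, g` is an exact pair of zero divisors, `R / g ≅ xR` is maximal Cohen-Macaulay without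
free summands. -/
theorem delta_quotient_eq_zero (hdim : ringKrullDim R = 1) {x g z : R} (hg : g ∈ maximalIdeal R)
    (hg0 : g ≠ 0) (hxg : x * g = 0) (hann : ∀ a, x * a = 0 → g ∣ a) (hz : z ∈ maximalIdeal R)
    (hreg : ∀ a, z * a = 0 → a = 0) {I : Ideal R} (hgI : g ∈ I) : delta R (R ⧸ I) = 0 := by
  have hle : Ideal.span {g} ≤ I := (Ideal.span_singleton_le_iff_mem _).mpr hgI
  have hnt : Nontrivial (R ⧸ Ideal.span {g}) := Ideal.Quotient.nontrivial_iff.mpr fun h =>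
    hg (Ideal.span_singleton_eq_top.mp h)
  refine Nat.sInf_eq_zero.mpr (Or.inl ⟨R ⧸ Ideal.span {g}, inferInstance, inferInstance,
    ⟨inferInstance, Or.inr ⟨[z], by simpa using hz, ?_, by simp [hdim]⟩⟩, ?_,
    Submodule.factor hle ∘ₗ LinearMap.fst R _ _,
    (Submodule.factor_surjective hle).comp fun r => ⟨(r, 0), rfl⟩⟩)
  · rw [isRegular_iff_isWeaklyRegular_of_subset_maximalIdeal (by simpa using hz),
      RingTheory.Sequence.isWeaklyRegular_singleton_iff]
    refine IsSMulRegular.of_right_eq_zero_of_smul ?_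
    intro a ha
    obtain ⟨a, rfl⟩ := Ideal.Quotient.mk_surjective a
    have h : z * a ∈ Ideal.span {g} := Ideal.Quotient.eq_zero_iff_mem.mp ha
    obtain ⟨b, hb⟩ := Ideal.mem_span_singleton.mp h
    refine Ideal.Quotient.eq_zero_iff_mem.mpr (Ideal.mem_span_singleton.mpr (hann a (hreg _ ?_)))
    rw [mul_left_comm, hb, ← mul_assoc, hxg, zero_mul]
  · intro F N _ hF
    -- `g ≠ 0` kills `R / g`, while a nonzero free module is faithful.
    have hgF (m : F) : g • m = 0 := by
      obtain ⟨m, hm⟩ := m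
      ext
      obtain ⟨a, rfl⟩ := Ideal.Quotient.mk_surjective m
      exact Ideal.Quotient.eq_zero_iff_mem.mpr
        (Ideal.mul_mem_right _ _ (Ideal.mem_span_singleton_self g))
    by_contra hne
    have : Nontrivial F := Submodule.nontrivial_iff_ne_bot.mpr hne
    obtain ⟨i⟩ := (Module.Free.chooseBasis R F).index_nonempty
    have := congrArg (fun m => (Module.Free.chooseBasis R F).repr m i)
      (hgF (Module.Free.chooseBasis R F i))
    simp at this
    exact hg0 this

/-- A parameter is regular on every maximal Cohen-Macaulay module. -/
theorem IsMaximalCohenMacaulay.eq_zero_of_smul_eq_zero {X : Type v} [AddCommGroup X] [Module R X]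
    (hX : IsMaximalCohenMacaulay R X) (hdim : ringKrullDim R = 1) {z : R} {d : ℕ}
    (hd : maximalIdeal R ^ d ≤ Ideal.span {z}) (m : X) (hm : z • m = 0) : m = 0 := by
  obtain ⟨_, _ | ⟨xs, hxs, hreg, hlen⟩⟩ := hX
  · exact Subsingleton.elim _ _
  rw [hdim] at hlen
  obtain ⟨w, rfl⟩ := List.length_eq_one_iff.mp (by exact_mod_cast hlen : xs.length = 1)
  have hw := (RingTheory.Sequence.isWeaklyRegular_singleton_iff X w).mp hreg.toIsWeaklyRegular
  -- A power of the regular element `w` is a multiple of `z`, so `z` is regular too.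
  obtain ⟨c, hc⟩ := Ideal.mem_span_singleton.mp (hd (Ideal.pow_mem_pow (hxs w (by simp)) d))
  refine (hw.pow d) ?_
  simp only [hc, mul_comm z, mul_smul, hm, smul_zero]

end Delta

/-! ### The ring k⟦x, y⟧ / (xy(x^q + y^q)) -/

variable {k : Type u} [Field k]

/-- The coordinates `x + 2y` and `y` present the ring as a quotient of `k⟦z⟧⟦y⟧`. -/
theorem exists_presentation (k : Type u) [Field k] (p : ℕ) [CharP k p] [Fact p.Prime] (n : ℕ) :
    ∃ π : PowerSeries (PowerSeries k) →+* HypersurfaceRing k (p ^ n), Function.Surjective π ∧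
      π (PowerSeries.C PowerSeries.X) = xbar k (p ^ n) + 2 * ybar k (p ^ n) ∧
      π PowerSeries.X = ybar k (p ^ n) ∧
      ∀ a, π a = 0 ↔ (PowerSeries.C PowerSeries.X - 2 * PowerSeries.X) * PowerSeries.X *
        ((PowerSeries.C PowerSeries.X) ^ p ^ n - PowerSeries.X ^ p ^ n) ∣ a := by
  obtain ⟨e, he0, he1⟩ := PowerSeries.exists_ringEquiv_mvPowerSeries k
  refine ⟨(Ideal.Quotient.mk (Ideal.span {equation k (p ^ n)})).comp e.symm.toRingHom,
    Ideal.Quotient.mk_surjective.comp e.symm.surjective, ?_, ?_, fun a => ?_⟩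
  · have : e.symm (PowerSeries.C PowerSeries.X) = MvPowerSeries.X 0 + 2 * MvPowerSeries.X 1 := by
      rw [RingEquiv.symm_apply_eq, map_add, map_mul, map_ofNat, he0, he1, sub_add_cancel]
    change Ideal.Quotient.mk _ (e.symm _) = _
    rw [this, map_add, map_mul, map_ofNat]
    rfl
  · change Ideal.Quotient.mk _ (e.symm _) = _
    rw [← he1, RingEquiv.symm_apply_apply]
    rfl
  · change Ideal.Quotient.mk _ (e.symm _) = 0 ↔ _
    rw [Ideal.Quotient.eq_zero_iff_mem, Ideal.mem_span_singleton]
    have : CharP (PowerSeries (PowerSeries k)) p :=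
      charP_of_injective_ringHom (f := PowerSeries.C.comp PowerSeries.C)
        (PowerSeries.C_injective.comp PowerSeries.C_injective) p
    -- Frobenius: x^q + y^q = (x + y)^q = (z - y)^q = z^q - y^q.
    rw [← map_dvd_iff e, RingEquiv.apply_symm_apply, equation, map_mul, map_mul, map_add, map_pow,
      map_pow, he0, he1, ← add_pow_char_pow, ← sub_pow_char_pow]
    ring_nf

section HypersurfaceRing

variable (q : ℕ)

theorem xbar_mul_eq_zero : xbar k q * (ybar k q * (xbar k q ^ q + ybar k q ^ q)) = 0 := by
  rw [← mul_assoc]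
  exact Ideal.Quotient.eq_zero_iff_mem.mpr (Ideal.mem_span_singleton_self (equation k q))

theorem equation_eq : equation k q = MvPowerSeries.X 0 * (MvPowerSeries.X 1 *
    (MvPowerSeries.X 0 ^ q + MvPowerSeries.X 1 ^ q)) := mul_assoc _ _ _

theorem dvd_of_xbar_mul_eq_zero (a : HypersurfaceRing k q) (ha : xbar k q * a = 0) :
    ybar k q * (xbar k q ^ q + ybar k q ^ q) ∣ a := by
  obtain ⟨s, rfl⟩ := Ideal.Quotient.mk_surjective a
  obtain ⟨t, ht⟩ := Ideal.mem_span_singleton.mp (Ideal.Quotient.eq_zero_iff_mem.mp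
    (ha : Ideal.Quotient.mk _ (MvPowerSeries.X 0 * s) = 0))
  rw [equation_eq, mul_assoc] at ht
  have hX : (MvPowerSeries.X 0 : MvPowerSeries (Fin 2) k) ≠ 0 :=
    nonZeroDivisors.ne_zero MvPowerSeries.X_mem_nonzeroDivisors
  rw [mul_left_cancel₀ hX ht]
  exact ⟨Ideal.Quotient.mk _ t, rfl⟩

theorem ybar_mul_ne_zero {q : ℕ} (hq : q ≠ 0) :
    ybar k q * (xbar k q ^ q + ybar k q ^ q) ≠ 0 := by
  intro h
  have h' : Ideal.Quotient.mk (Ideal.span {equation k q}) (MvPowerSeries.X 1 *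
      (MvPowerSeries.X 0 ^ q + MvPowerSeries.X 1 ^ q)) = 0 := h
  rw [Ideal.Quotient.eq_zero_iff_mem, Ideal.mem_span_singleton, equation_eq, mul_add,
    ← pow_succ'] at h'
  -- Since x divides both the equation and yx^q, it would divide y^(q+1).
  have hdvd := (dvd_add_right (dvd_mul_of_dvd_right (dvd_pow_self (MvPowerSeries.X 0) hq) _)).mp
    ((dvd_mul_right (MvPowerSeries.X 0) _).trans h')
  have := MvPowerSeries.X_dvd_iff.mp hdvd (Finsupp.single 1 (q + 1)) (by simp)
  simp [MvPowerSeries.coeff_X_pow] at this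

end HypersurfaceRing

end LoewyIndex

/-! ### The main theorem -/

theorem corollary3p8 (k : Type u) [Field k] (p : ℕ) [CharP k p] (hp : 2 < p) (n : ℕ) :
    maximalIdeal (LoewyIndex.HypersurfaceRing k (p ^ n)) ^ (p ^ n + 2) =
      Ideal.span {LoewyIndex.xbar k (p ^ n) + 2 * LoewyIndex.ybar k (p ^ n)} *
        maximalIdeal (LoewyIndex.HypersurfaceRing k (p ^ n)) ^ (p ^ n + 1) ∧
    LoewyIndex.gll (LoewyIndex.HypersurfaceRing k (p ^ n)) = ((p ^ n + 2 : ℕ) : ℕ∞) ∧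
    LoewyIndex.index (LoewyIndex.HypersurfaceRing k (p ^ n)) = ((p ^ n + 2 : ℕ) : ℕ∞) := by
  have hprime : p.Prime := (CharP.char_is_prime_or_zero k p).resolve_right (by omega)
  have : Fact p.Prime := ⟨hprime⟩
  obtain ⟨π, hπ, hπz, hπy, hker⟩ := LoewyIndex.exists_presentation k p n
  have h2 : (2 : k) ≠ 0 := by
    have := CharP.cast_eq_zero_iff k p 2
    intro h
    exact absurd (Nat.le_of_dvd two_pos (this.mp (by exact_mod_cast h))) (by omega)
  have hq0 : p ^ n ≠ 0 := pow_ne_zero _ hprime.ne_zero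
  generalize p ^ n = q at *
  set m := maximalIdeal (LoewyIndex.HypersurfaceRing k q) with hm_def
  set x := LoewyIndex.xbar k q with hx
  set y := LoewyIndex.ybar k q with hy
  set z := x + 2 * y with hz
  have hx' : x = z - 2 * y := by rw [hz]; ring
  clear_value z
  set g := y * (x ^ q + y ^ q) with hg
  set F : PowerSeries (PowerSeries k) :=
    (PowerSeries.C PowerSeries.X - 2 * PowerSeries.X) * PowerSeries.X *
      ((PowerSeries.C PowerSeries.X) ^ q - PowerSeries.X ^ q) with hF
  have hm : m = Ideal.span {z, y} := by
    rw [hm_def, PowerSeries.maximalIdeal_eq_span_pair PowerSeries.maximalIdeal_eq_span_X hπ, hπz, hπy]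
  have hzm : z ∈ m := hm ▸ Ideal.subset_span (by simp)
  have hym : y ∈ m := hm ▸ Ideal.subset_span (by simp)
  have hxm : x ∈ m := hx' ▸ Ideal.sub_mem _ hzm (Ideal.mul_mem_left _ _ hym)
  have hunit : IsUnit (2 : LoewyIndex.HypersurfaceRing k q) := by
    have := (isUnit_iff_ne_zero.mpr h2).map (algebraMap k (LoewyIndex.HypersurfaceRing k q))
    rwa [map_ofNat] at this
  have hrel : (z - 2 * y) * y * (z ^ q - y ^ q) = 0 := by
    have := (hker F).mpr dvd_rfl
    rwa [hF, map_mul, map_mul, map_sub, map_mul, map_sub, map_pow, map_pow, map_ofNat, hπz, hπy]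
      at this
  have hypow : y ^ (q + 2) ∈ Ideal.span {z} * m ^ (q + 1) := by
    obtain ⟨r, hr⟩ := Nat.exists_eq_succ_of_ne_zero hq0
    have hzq : z ^ q = z * z ^ r := (congrArg (z ^ ·) hr).trans (pow_succ' z r)
    have hmq : m ^ (q + 1) = m ^ 2 * m ^ r :=
      (congrArg (m ^ ·) (by omega : q + 1 = 2 + r)).trans (pow_add m 2 r)
    rw [← Ideal.unit_mul_mem_iff_mem _ hunit]
    -- The defining relation solved for its only term without a factor z.
    have : 2 * y ^ (q + 2) = z * (y ^ (q + 1) - y * z ^ q + 2 * (y ^ 2 * z ^ r)) := by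
      linear_combination hrel + 2 * y ^ 2 * hzq
    rw [this]
    refine Ideal.mul_mem_mul (Ideal.mem_span_singleton_self z) (Ideal.add_mem _ (Ideal.sub_mem _
      (Ideal.pow_mem_pow hym _) ?_) (Ideal.mul_mem_left _ _ ?_))
    · rw [pow_succ' m]
      exact Ideal.mul_mem_mul hym (Ideal.pow_mem_pow hzm _)
    · rw [hmq]
      exact Ideal.mul_mem_mul (Ideal.pow_mem_pow hym _) (Ideal.pow_mem_pow hzm _)
  have hpow : m ^ (q + 2) = Ideal.span {z} * m ^ (q + 1) := by
    apply le_antisymm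
    · have h := Ideal.sup_pow_succ_le (Ideal.span {z}) (Ideal.span {y}) (q + 1)
      rw [← Ideal.span_insert, ← hm, Ideal.span_singleton_pow] at h
      exact h.trans (sup_le le_rfl ((Ideal.span_singleton_le_iff_mem _).mpr hypow))
    · rw [pow_succ' _ (q + 1)]
      exact Ideal.mul_mono_left ((Ideal.span_singleton_le_iff_mem _).mpr hzm)
  have hle : m ^ (q + 2) ≤ Ideal.span {z} := hpow.trans_le Ideal.mul_le_left
  let : Algebra (PowerSeries k) (LoewyIndex.HypersurfaceRing k q) := (π.comp PowerSeries.C).toAlgebra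
  have hC : ∀ a, π (PowerSeries.C a) = algebraMap (PowerSeries k) (LoewyIndex.HypersurfaceRing k q) a :=
    fun _ => rfl
  have hzA : algebraMap (PowerSeries k) (LoewyIndex.HypersurfaceRing k q) PowerSeries.X = z := hπz
  have hres : residue (PowerSeries k) PowerSeries.X = 0 := by
    rw [residue_eq_zero_iff, PowerSeries.maximalIdeal_eq_span_X]
    exact Ideal.mem_span_singleton_self _
  have hFres : F.map (residue (PowerSeries k)) = PowerSeries.X ^ (q + 1 + 1) * 2 := by
    simp only [hF, map_mul, map_sub, map_pow, PowerSeries.map_C, PowerSeries.map_X, hres, map_zero,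
      map_ofNat, zero_pow hq0]
    ring
  have hF0 : F.map (residue (PowerSeries k)) ≠ 0 := by
    rw [hFres]
    refine mul_ne_zero (pow_ne_zero _ PowerSeries.X_ne_zero) ?_
    have := (isUnit_iff_ne_zero.mpr h2).map
      (PowerSeries.C.comp ((residue (PowerSeries k)).comp PowerSeries.C))
    rw [map_ofNat] at this
    exact this.ne_zero
  have hcomp : IsAdicComplete (maximalIdeal (PowerSeries k)) (PowerSeries k) := by
    rw [PowerSeries.maximalIdeal_eq_span_X]
    infer_instance
  have hreg : ∀ a, z * a = 0 → a = 0 := fun a ha =>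
    PowerSeries.eq_zero_of_smul_eq_zero_of_surjective hπ hC hker PowerSeries.X_irreducible hF0 a
      (by rw [Algebra.smul_def, hzA, ha])
  have hdim := ringKrullDim_eq_one_of_pow_le_span_singleton hzm hreg hle
  have hgm : g ∈ m ^ (q + 1) := by
    rw [pow_succ' m]
    exact Ideal.mul_mem_mul hym (Ideal.add_mem _ (Ideal.pow_mem_pow hxm _) (Ideal.pow_mem_pow hym _))
  have hg0 : g ≠ 0 := LoewyIndex.ybar_mul_ne_zero hq0
  have hxg : x * g = 0 := LoewyIndex.xbar_mul_eq_zero q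
  have hann : ∀ a, x * a = 0 → g ∣ a := LoewyIndex.dvd_of_xbar_mul_eq_zero q
  refine ⟨hpow, ?_, ?_⟩
  · apply le_antisymm
    · refine sInf_le ⟨q + 2, ⟨by omega, [z], ⟨by simp [hdim],
        by simpa only [List.mem_singleton, forall_eq] using hzm, ?_⟩, ?_⟩, rfl⟩
      · rw [Ideal.ofList_singleton]
        apply le_antisymm
        · rw [← (maximalIdeal.isMaximal (LoewyIndex.HypersurfaceRing k q)).isPrime.radical]
          exact Ideal.radical_mono ((Ideal.span_singleton_le_iff_mem _).mpr hzm)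
        · exact fun a ha => ⟨q + 2, hle (Ideal.pow_mem_pow ha _)⟩
      · rwa [Ideal.ofList_singleton]
    · refine le_sInf ?_
      rintro _ ⟨j, ⟨hj, xs, ⟨hlen, hxs, -⟩, hjle⟩, rfl⟩
      rw [hdim] at hlen
      obtain ⟨w, rfl⟩ := List.length_eq_one_iff.mp (by exact_mod_cast hlen : xs.length = 1)
      rw [Ideal.ofList_singleton] at hjle
      refine Nat.cast_le.mpr ?_
      by_contra! hlt
      have hjle' := (Ideal.pow_le_pow_right (by omega : j ≤ q + 1)).trans hjle
      -- The regular element z^(q+1) is a multiple of `w`, so `w` is regular.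
      obtain ⟨c, hc⟩ := Ideal.mem_span_singleton.mp (hjle' (Ideal.pow_mem_pow hzm _))
      have hwreg : ∀ a, w * a = 0 → a = 0 := by
        intro a ha
        have h : ∀ i, z ^ i * a = 0 → a = 0 := by
          intro i
          induction i with
          | zero => simp
          | succ i ih => exact fun h => ih (hreg _ (by rw [← mul_assoc, ← pow_succ', h]))
        exact h (q + 1) (by rw [hc, mul_right_comm, ha, zero_mul])
      obtain ⟨a, ha⟩ := Ideal.mem_span_singleton.mp (hjle' hgm)
      -- From g = wa and xg = 0 regularity gives xa = 0, so a = gb and g(1 - wb) = 0.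
      obtain ⟨b, rfl⟩ := hann a (hwreg _ (by rw [mul_left_comm, ← ha, hxg]))
      have hu : IsUnit (1 - w * b) := by
        have : w * b ∈ m := Ideal.mul_mem_right _ _ (hxs w (by simp))
        exact (isUnit_or_isUnit_one_sub_self (w * b)).resolve_left this
      refine hg0 (hu.mul_left_eq_zero.mp ?_)
      linear_combination ha
  · apply le_antisymm
    · refine sInf_le ⟨q + 2, ⟨by omega, LoewyIndex.delta_quotient_eq_one fun X _ _ hX hX' f hf => ?_⟩, rfl⟩
      have := hX.1
      have hlez : maximalIdeal (LoewyIndex.HypersurfaceRing k q) ^ (q + 2) ≤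
          Ideal.span {algebraMap (PowerSeries k) _ PowerSeries.X} := by rwa [hzA]
      obtain ⟨F', N, hFN, hfree, hne⟩ := PowerSeries.exists_isCompl_free (d := q + 1) hπ hC hker
        PowerSeries.X_irreducible hF0 (hFres ▸ dvd_mul_right _ _)
        (by rw [hπy, hzA]; exact hle (Ideal.pow_mem_pow hym _)) (M := X)
        (by rw [hzA]; exact hX.eq_zero_of_smul_eq_zero hdim hle)
        (Submodule.factor hlez ∘ₗ f)
        ((Submodule.factor_surjective hlez).comp hf)
      exact hne (hX' F' N hFN hfree)
    · refine le_sInf ?_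
      rintro _ ⟨j, ⟨hj, hδ⟩, rfl⟩
      refine Nat.cast_le.mpr ?_
      by_contra! hlt
      have := LoewyIndex.delta_quotient_eq_zero hdim (Ideal.pow_le_self (by omega) hgm) hg0 hxg hann hzm hreg
        (Ideal.pow_le_pow_right (by omega : j ≤ q + 1) hgm)
      exact zero_ne_one (this.symm.trans hδ)
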